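/- Let $X$ be a separable, infinite-dimensional (real or complex) Banach space that is not uniformly finitely extensible, i.e. there is no $\lambda\ge 1$ such that every linear operator $t:E\to X$ defined on a finite-dimensional subspace $E\subset X$ extends to a bounded operator $\hat t:X\to X$ with $\|\hat t\|\le\lambda\|t\|$. For a closed infinite-dimensional subspace $Y\subset X$ let $\mathrm{Emb}(Y,X)$ be the set of bounded linear operators from $Y$ to $X$ that are isomorphisms onto a subspace of infinite codimension in $X$, with the Borel structure generated by the strong operator topology, and let $T\sim U$ mean that $T=AU$ for some automorphism $A$ of $X$ (the relation of position). On $2^\omega$ write $\alpha\,E_0^m\,\beta$ if $\alpha(n)=\beta(n)$ for all $n\ge m$, and $\alpha\,E_0\,\beta$ if $\alpha\,E_0^m\,\beta$ for some $m$. Then there is a closed infinite-dimensional subspace $Y$ of $X$ such that $E_0$ is Borel reducible to $(\mathrm{Emb}(Y,X),\sim)$. In particular the positions of $Y$ in $X$ are not smooth, i.e. $\sim$ is not Borel reducible to equality on $\mathbb{R}$. Moreover, there are compact operators $T_\alpha:Y\to X$ ($\alpha\in 2^\omega$) with $\|T_\alpha\|\le 1$ such that for every $0<\varepsilon<1$,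 writing $A_\alpha=\mathrm{Id}+\varepsilon T_\alpha$ with $\mathrm{Id}$ the inclusion of $Y$ into $X$, the map $\alpha\mapsto A_\alpha$ takes values in $\mathrm{Emb}(Y,X)$ and is a Borel reduction of $E_0$ to $\sim$, and: 1. there are integers $(c_m)_m$ such that, whenever $\alpha\,E_0^m\,\beta$, there is an automorphism $\tau$ of $X$ with $\tau A_\alpha=A_\beta$ and $\max\{\|\tau\|,\|\tau^{-1}\|\}\le c_m$; 2. whenever $n\ge m$, $\alpha(n)=0$ and $\beta(n)=1$, every bounded operator $\tau:X\to X$ with $\tau A_\alpha=A_\beta$ satisfies $\|\tau\|\ge\tfrac12(\varepsilon 2^m-1)$. -/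

import Mathlib

universe u v

/-! ### Borel reducibility of equivalence relations -/

/-- `f` is a Borel reduction of the equivalence relation `R` to the equivalence relation `S`. -/
def IsBorelReduction {E : Type u} {F : Type v} [MeasurableSpace E] [MeasurableSpace F]
    (R : Setoid E) (S : Setoid F) (f : E → F) : Prop :=
  Measurable f ∧ ∀ x y : E, R x y ↔ S (f x) (f y)

/-- `R` is Borel reducible to `S`. -/
def BorelReducible {E : Type u} {F : Type v} [MeasurableSpace E] [MeasurableSpace F]
    (R : Setoid E) (S : Setoid F) : Prop :=
  ∃ f : E → F, IsBorelReduction R S f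

/-- A relation is smooth if it is Borel reducible to equality of real numbers
(`⊥` is the setoid of equality). -/
def IsSmoothRel {E : Type u} [MeasurableSpace E] (R : Setoid E) : Prop :=
  BorelReducible R (⊥ : Setoid ℝ)

/-- `α E₀ᵐ β`: the `0`-`1` sequences `α` and `β` agree from index `m` on. -/
def AgreeFrom (m : ℕ) (α β : ℕ → Bool) : Prop :=
  ∀ n : ℕ, m ≤ n → α n = β n

/-- The relation `E₀` of eventual agreement on `2^ω`. -/
def relE0 : Setoid (ℕ → Bool) where
  r α β := ∃ m : ℕ, AgreeFrom m α β
  iseqv :=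
    { refl := fun _ => ⟨0, fun _ _ => rfl⟩
      symm := fun ⟨m, h⟩ => ⟨m, fun n hn => (h n hn).symm⟩
      trans := fun ⟨m, h⟩ ⟨k, h'⟩ => ⟨max m k, fun n hn =>
        (h n (le_trans (le_max_left _ _) hn)).trans
          (h' n (le_trans (le_max_right _ _) hn))⟩ }

/-! ### Uniformly finitely extensible spaces -/

/-- `X` is uniformly finitely extensible (UFO): for some `c ≥ 1`, every linear operator `t` from a
finite-dimensional subspace of `X` into `X` extends to an operator on `X` of norm at most
`c * ‖t‖`. -/
def IsUFO (𝕜 : Type v) [RCLike 𝕜] (X : Type u) [NormedAddCommGroup X] [NormedSpace 𝕜 X] : Prop :=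
  ∃ c : ℝ, 1 ≤ c ∧ ∀ E : Submodule 𝕜 X, FiniteDimensional 𝕜 E → ∀ t : E →L[𝕜] X,
    ∃ T : X →L[𝕜] X, (∀ e : E, T (e : X) = t e) ∧ ‖T‖ ≤ c * ‖t‖

/-! ### Embeddings and positions -/

/-- `Emb(Y, X)`: the bounded linear operators from `Y` to `X` that are isomorphisms onto a subspace
of infinite codimension. -/
structure Emb (𝕜 : Type*) [RCLike 𝕜] (Y : Type*) [NormedAddCommGroup Y] [NormedSpace 𝕜 Y]
    (X : Type*) [NormedAddCommGroup X] [NormedSpace 𝕜 X] where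
  /-- The underlying operator. -/
  toCLM : Y →L[𝕜] X
  bounded_below : ∃ c : ℝ, 0 < c ∧ ∀ y : Y, c * ‖y‖ ≤ ‖toCLM y‖
  infinite_codim : ¬ FiniteDimensional 𝕜 (X ⧸ LinearMap.range toCLM.toLinearMap)

namespace Emb

variable {𝕜 : Type*} [RCLike 𝕜] {Y : Type*} [NormedAddCommGroup Y] [NormedSpace 𝕜 Y]
  {X : Type*} [NormedAddCommGroup X] [NormedSpace 𝕜 X]

/-- The strong operator topology on `Emb(Y, X)`. -/
instance instTopologicalSpace : TopologicalSpace (Emb 𝕜 Y X) :=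
  TopologicalSpace.induced
    (fun T : Emb 𝕜 Y X => ContinuousLinearMap.toPointwiseConvergenceCLM 𝕜 (RingHom.id 𝕜) Y X T.toCLM)
    inferInstance

/-- The Borel structure of `Emb(Y, X)`, generated by the strong operator topology. -/
instance instMeasurableSpace : MeasurableSpace (Emb 𝕜 Y X) := borel (Emb 𝕜 Y X)

/-- The relation `T ∼ U` of being in the same position: `T = A U` for some automorphism `A` of
`X`. -/
def position (𝕜 : Type*) [RCLike 𝕜] (Y : Type*) [NormedAddCommGroup Y] [NormedSpace 𝕜 Y]
    (X : Type*) [NormedAddCommGroup X] [NormedSpace 𝕜 X] : Setoid (Emb 𝕜 Y X) where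
  r T U := ∃ A : X ≃L[𝕜] X, ∀ y : Y, T.toCLM y = A (U.toCLM y)
  iseqv :=
    { refl := fun _ => ⟨ContinuousLinearEquiv.refl 𝕜 X, fun _ => rfl⟩
      symm := fun ⟨A, h⟩ => ⟨A.symm, fun y => by rw [h y, A.symm_apply_apply]⟩
      trans := fun ⟨A, h⟩ ⟨B, h'⟩ => ⟨B.trans A, fun y => by
        rw [h y, h' y]; rfl⟩ }

/-- `U ∼_c V`: there is an automorphism `A` of `X` with `A U = V` and
`max (‖A‖, ‖A⁻¹‖) ≤ c`. -/
def SamePositionWithin (c : ℝ) (U V : Emb 𝕜 Y X) : Prop :=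
  ∃ A : X ≃L[𝕜] X, (∀ y : Y, A (U.toCLM y) = V.toCLM y) ∧
    max ‖(A : X →L[𝕜] X)‖ ‖(A.symm : X →L[𝕜] X)‖ ≤ c

end Emb

/-! Failure of uniform finite extensibility persists in every closed subspace of finite codimension
(`exists_badly_extensible`). Hence one can build, block by block, finite-dimensional spaces `E n`,
nearly independent of each other, and finite-rank operators `S n` that have norm of order `2 ^ (-n)`
on the closed span `Y` of the `E n`, while no extension of `S n` from `E n` to `X` has norm below `2
^ n`. Moreover all products `S n ∘ S k` vanish, and `S k` kills `E n` for `k ≠ n`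
(`exists_isBlockSystem`).

A sequence `c` is coded by the inclusion of `Y` perturbed by `ε` times the sum of the `S n` with `c
n = 1`. If `c` and `d` differ at finitely many places, the difference of the perturbations is the
restriction of an operator `B` on `X` with `B² = 0`, and `1 + B` is an automorphism carrying one
embedding to the other. If `τ` carries one to the other and `c n = 0`, `d n = 1`, then `(τ - 1) / ε`
extends `S n` from `E n`, so `‖τ‖` is at least `ε 2 ^ n - 1`; infinitely many differences are thus
impossible, on applying this to `τ` or `τ⁻¹`. Non-smoothness follows from that of `E₀`, by a
zero-one law. -/

/-! ### Extending operators from finite-dimensional subspaces. -/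

section Extension

variable {𝕜 : Type*} [RCLike 𝕜] {X : Type*} [NormedAddCommGroup X] [NormedSpace 𝕜 X]

/-- Operators of rank at most `d` on subspaces extend with norm increased by a factor at most
`2 ^ d - 1`. -/
theorem exists_extension_norm_le_of_rank_le (d : ℕ) : ∀ (E F : Submodule 𝕜 X) (t : E →L[𝕜] X),
    FiniteDimensional 𝕜 F → Module.finrank 𝕜 F ≤ d → (∀ e, t e ∈ F) →
    ∃ T : X →L[𝕜] X, (∀ e : E, T e = t e) ∧ ‖T‖ ≤ (2 ^ d - 1) * ‖t‖ := by
  induction d with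
  | zero =>
    intro E F t hF hd ht
    have hbot : F = ⊥ := Submodule.finrank_eq_zero.1 (Nat.le_zero.1 hd)
    refine ⟨0, fun e => ?_, by simp⟩
    have := ht e
    rw [hbot, Submodule.mem_bot] at this
    simp [this]
  | succ d ih =>
    intro E F t hF hd ht
    by_cases h0 : ∀ e, t e = 0
    · refine ⟨0, fun e => by simp [h0 e], ?_⟩
      rw [norm_zero]
      have : (1 : ℝ) ≤ 2 ^ (d + 1) := one_le_pow₀ (by norm_num)
      exact mul_nonneg (by linarith) (norm_nonneg _)
    push Not at h0
    obtain ⟨y, hy⟩ := h0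
    -- Split off the rank-one part `(f ∘ t) ⊗ x`, which extends by Hahn–Banach. The remainder maps
    -- into `F ∩ ker f` and has norm at most `2‖t‖`, so the constants satisfy `K (d + 1) = 2 * K d +
    -- 1`.
    obtain ⟨f, hf1, hfy⟩ := exists_dual_vector 𝕜 (t y) (norm_ne_zero_iff.2 hy)
    set x : X := ((‖t y‖⁻¹ : ℝ) : 𝕜) • t y with hx
    have hxn : ‖x‖ = 1 := by
      rw [hx, norm_smul, RCLike.norm_ofReal, abs_of_nonneg (by positivity)]
      exact inv_mul_cancel₀ (norm_ne_zero_iff.2 hy)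
    have hfx : f x = 1 := by
      rw [hx, map_smul, hfy, smul_eq_mul, ← RCLike.ofReal_mul,
        inv_mul_cancel₀ (norm_ne_zero_iff.2 hy), RCLike.ofReal_one]
    have hxF : x ∈ F := F.smul_mem _ (ht y)
    have hft : ‖f.comp t‖ ≤ ‖t‖ := by
      simpa [hf1] using f.opNorm_comp_le t
    obtain ⟨g, hg, hgn⟩ := exists_extension_norm_eq E (f.comp t)
    have hlt : Module.finrank 𝕜 ↥(F ⊓ LinearMap.ker f.toLinearMap) ≤ d := by
      refine Nat.le_of_lt_succ (lt_of_lt_of_le (Submodule.finrank_lt_finrank_of_lt ?_) hd)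
      refine lt_of_le_of_ne inf_le_left fun h => ?_
      rw [← h] at hxF
      have : f x = 0 := hxF.2
      simp [hfx] at this
    obtain ⟨T, hT, hTn⟩ := ih E (F ⊓ LinearMap.ker f.toLinearMap)
      (t - (f.comp t).smulRight x)
      (Submodule.finiteDimensional_of_le (inf_le_left : _ ≤ F)) hlt (fun e => by
        refine ⟨F.sub_mem (ht e) (F.smul_mem _ hxF), ?_⟩
        change f (t e - f (t e) • x) = 0
        simp [hfx])
    refine ⟨T + g.smulRight x, fun e => ?_, ?_⟩
    · simp [hT, hg]
    · have h1 : ‖t - (f.comp t).smulRight x‖ ≤ 2 * ‖t‖ := by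
        refine (norm_sub_le _ _).trans ?_
        rw [ContinuousLinearMap.norm_smulRight_apply, hxn]
        linarith
      have h2 : ‖g.smulRight x‖ ≤ ‖t‖ := by
        rw [ContinuousLinearMap.norm_smulRight_apply, hxn, hgn]
        linarith
      have h3 : (0 : ℝ) ≤ 2 ^ d - 1 := sub_nonneg.2 (one_le_pow₀ (by norm_num))
      calc ‖T + g.smulRight x‖ ≤ ‖T‖ + ‖g.smulRight x‖ := norm_add_le _ _
        _ ≤ (2 ^ d - 1) * (2 * ‖t‖) + ‖t‖ :=
          add_le_add (hTn.trans (mul_le_mul_of_nonneg_left h1 h3)) h2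
        _ = (2 ^ (d + 1) - 1) * ‖t‖ := by ring

/-- If `X` is not uniformly finitely extensible, then badly extensible operators exist between
finite-dimensional subspaces of any given closed subspace of finite codimension. -/
theorem exists_badly_extensible (hX : ¬ IsUFO 𝕜 X) (Z : Submodule 𝕜 X) (hZc : IsClosed (Z : Set X))
    (hZ : Z.CoFG) (N : ℝ) {δ : ℝ} (hδ : 0 < δ) :
    ∃ E : Submodule 𝕜 X, E ≤ Z ∧ FiniteDimensional 𝕜 E ∧ ∃ t : E →L[𝕜] X, (∀ e, t e ∈ Z) ∧
      ‖t‖ ≤ δ ∧ ∀ T : X →L[𝕜] X, (∀ e : E, T e = t e) → N ≤ ‖T‖ := by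
  by_contra! h
  have scaled : ∀ E : Submodule 𝕜 X, E ≤ Z → FiniteDimensional 𝕜 E → ∀ t : E →L[𝕜] X,
      (∀ e, t e ∈ Z) → ∃ T : X →L[𝕜] X, (∀ e : E, T e = t e) ∧ ‖T‖ ≤ |N| / δ * ‖t‖ := by
    intro E hE hEf t ht
    by_cases h0 : t = 0
    · exact ⟨0, fun e => by simp [h0], by simp [h0]⟩
    have hpos : 0 < ‖t‖ := norm_pos_iff.2 h0
    have hs : 0 < δ / ‖t‖ := div_pos hδ hpos
    obtain ⟨T, hT, hTN⟩ := h E hE hEf (((δ / ‖t‖ : ℝ) : 𝕜) • t)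
      (fun e => Z.smul_mem _ (ht e)) (by
        rw [norm_smul, RCLike.norm_ofReal, abs_of_pos hs, div_mul_cancel₀ _ hpos.ne'])
    refine ⟨(((δ / ‖t‖)⁻¹ : ℝ) : 𝕜) • T, fun e => ?_, ?_⟩
    · rw [smul_apply, hT, smul_apply, smul_smul,
        ← RCLike.ofReal_mul, inv_mul_cancel₀ hs.ne', RCLike.ofReal_one, one_smul]
    · rw [norm_smul, RCLike.norm_ofReal, abs_of_pos (inv_pos.2 hs), inv_div]
      calc ‖t‖ / δ * ‖T‖ ≤ ‖t‖ / δ * |N| :=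
            mul_le_mul_of_nonneg_left (hTN.le.trans (le_abs_self N)) (by positivity)
        _ = |N| / δ * ‖t‖ := by ring
  obtain ⟨P, hP⟩ := Submodule.ClosedComplemented.of_finiteDimensional_quotient (𝕜 := 𝕜) hZc
  set p : X →L[𝕜] X := Z.subtypeL.comp P with hp
  have hpZ : ∀ x, p x ∈ Z := fun x => (P x).2
  have hpz : ∀ z ∈ Z, p z = z := fun z hz => by simp [hp, hP ⟨z, hz⟩]
  set F : Submodule 𝕜 X := LinearMap.ker P.toLinearMap with hF
  have hcompl : IsCompl Z F := LinearMap.isCompl_of_proj hP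
  have hFf : FiniteDimensional 𝕜 F := .of_fg (Submodule.CoFG.fg_of_isCompl hcompl hZ)
  have hqF : ∀ x, x - p x ∈ F := fun x => by
    rw [hF, LinearMap.mem_ker]
    change P (x - p x) = 0
    rw [map_sub, sub_eq_zero]
    exact (hP (P x)).symm
  set d := Module.finrank 𝕜 F with hd
  set K : ℝ := 2 ^ d - 1 with hK
  have hK0 : 0 ≤ K := sub_nonneg.2 (one_le_pow₀ (by norm_num))
  set a : ℝ := |N| / δ * ‖p‖ with ha
  set b : ℝ := K * (1 + ‖p‖) with hb
  have ha0 : 0 ≤ a := by positivity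
  have hb0 : 0 ≤ b := by positivity
  -- With `p` a projection onto `Z`, `T₁` extends `p t` from `E ∩ Z` (cost `a`), `T₂` extends `(1 -
  -- p) t` from there, of rank at most `d` (cost `b`), and `T₃` extends what is left of `t` on `E`,
  -- which vanishes on `E ∩ Z` and so also has rank at most `d`. The final `+ 1` only makes the
  -- constant at least `1`.
  refine hX ⟨a + b + K * (1 + a + b) + 1, ?_, ?_⟩
  · have : 0 ≤ K * (1 + a + b) := by positivity
    linarith
  intro E hE t
  let ι : ↥(E ⊓ Z) →L[𝕜] E :=
    (E ⊓ Z).subtypeL.codRestrict E fun x => x.2.1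
  have hι : ∀ x, ((ι x : E) : X) = x := fun x => rfl
  have htι : ‖t.comp ι‖ ≤ ‖t‖ :=
    ContinuousLinearMap.opNorm_le_bound _ (norm_nonneg _) fun x => t.le_opNorm (ι x)
  have hpt : ‖p.comp (t.comp ι)‖ ≤ ‖p‖ * ‖t‖ :=
    (p.opNorm_comp_le _).trans (mul_le_mul_of_nonneg_left htι (norm_nonneg _))
  obtain ⟨T₁, hT₁, hT₁n⟩ := scaled (E ⊓ Z) inf_le_right
    (Submodule.finiteDimensional_of_le (inf_le_left : _ ≤ E)) (p.comp (t.comp ι))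
    (fun e => hpZ _)
  have hT₁n' : ‖T₁‖ ≤ a * ‖t‖ := by
    refine hT₁n.trans ?_
    rw [ha, mul_assoc]
    exact mul_le_mul_of_nonneg_left hpt (by positivity)
  obtain ⟨T₂, hT₂, hT₂n⟩ := exists_extension_norm_le_of_rank_le d (E ⊓ Z) F
    (t.comp ι - p.comp (t.comp ι)) hFf le_rfl (fun e => hqF _)
  have hT₂n' : ‖T₂‖ ≤ b * ‖t‖ := by
    refine hT₂n.trans ?_
    rw [hb, mul_assoc]
    refine mul_le_mul_of_nonneg_left ((norm_sub_le _ _).trans ?_) hK0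
    linarith
  let t₃ : E →L[𝕜] X := t - (T₁ + T₂).comp E.subtypeL
  have ht₃ : ∀ e : E, (e : X) ∈ Z → t₃ e = 0 := by
    intro e he
    have h1 := hT₁ ⟨e, e.2, he⟩
    have h2 := hT₂ ⟨e, e.2, he⟩
    change t e - (T₁ e + T₂ e) = 0
    change T₁ e = p (t e) at h1
    change T₂ e = t e - p (t e) at h2
    rw [h1, h2]
    abel
  have ht₃n : ‖t₃‖ ≤ (1 + a + b) * ‖t‖ := by
    have h1 : ‖(T₁ + T₂).comp E.subtypeL‖ ≤ ‖T₁ + T₂‖ :=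
      ContinuousLinearMap.opNorm_le_bound _ (norm_nonneg _) fun x => (T₁ + T₂).le_opNorm x
    have h2 := norm_sub_le t ((T₁ + T₂).comp E.subtypeL)
    have h3 := norm_add_le T₁ T₂
    change ‖t - _‖ ≤ _
    linarith
  have hrank : Module.finrank 𝕜 (LinearMap.range t₃.toLinearMap) ≤ d := by
    let q : E →ₗ[𝕜] F :=
      LinearMap.codRestrict F (E.subtype - p.toLinearMap.comp E.subtype) fun e => hqF e
    have h1 := t₃.toLinearMap.finrank_range_add_finrank_ker
    have h2 := q.finrank_range_add_finrank_ker
    have h3 : LinearMap.ker q ≤ LinearMap.ker t₃.toLinearMap := by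
      intro e he
      have : (e : X) - p e = 0 := congrArg Subtype.val he
      refine ht₃ e ?_
      rw [sub_eq_zero.1 this]
      exact hpZ _
    have h4 := Submodule.finrank_mono h3
    have h5 := Submodule.finrank_le (LinearMap.range q)
    omega
  obtain ⟨T₃, hT₃, hT₃n⟩ := exists_extension_norm_le_of_rank_le d E
    (LinearMap.range t₃.toLinearMap) t₃ inferInstance hrank (fun e => ⟨e, rfl⟩)
  refine ⟨T₁ + T₂ + T₃, fun e => ?_, ?_⟩
  · change T₁ e + T₂ e + T₃ e = t e
    rw [hT₃]
    change T₁ e + T₂ e + (t e - (T₁ e + T₂ e)) = t e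
    abel
  · have h1 := norm_add_le (T₁ + T₂) T₃
    have h2 := norm_add_le T₁ T₂
    have h3 : ‖T₃‖ ≤ K * ((1 + a + b) * ‖t‖) :=
      hT₃n.trans (mul_le_mul_of_nonneg_left ht₃n hK0)
    have h4 := norm_nonneg t
    linarith

theorem exists_continuousLinearMap_extension (E : Submodule 𝕜 X) [FiniteDimensional 𝕜 E]
    {G : Type*} [NormedAddCommGroup G] [NormedSpace 𝕜 G] (t : E →ₗ[𝕜] G) :
    ∃ T : X →L[𝕜] G, ∀ e : E, T e = t e := by
  obtain ⟨T, hT⟩ := (LinearMap.toContinuousLinearMap t).exist_extension_of_finiteDimensional_range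
  exact ⟨T, fun e => (DFunLike.congr_fun hT e).symm⟩

/-- The operator of `exists_badly_extensible` can moreover be chosen with range disjoint from its
domain. -/
theorem exists_badly_extensible_disjoint (hdim : ¬ FiniteDimensional 𝕜 X) (hX : ¬ IsUFO 𝕜 X)
    (Z : Submodule 𝕜 X) (hZc : IsClosed (Z : Set X)) (hZ : Z.CoFG) (N : ℝ) {δ : ℝ} (hδ : 0 < δ) :
    ∃ E : Submodule 𝕜 X, E ≤ Z ∧ FiniteDimensional 𝕜 E ∧ ∃ t : E →L[𝕜] X, (∀ e, t e ∈ Z) ∧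
      ‖t‖ ≤ δ ∧ (∀ e, t e ∈ E → t e = 0) ∧
      ∀ T : X →L[𝕜] X, (∀ e : E, T e = t e) → N ≤ ‖T‖ := by
  -- The slack in `N + 1` and `δ / 2` pays for adding a small injection `η r` of `E` into `C ∩ Z`,
  -- where `C` is a complement of `E + t(E)`. A value of `t + η r` lying in `E` then forces `r e =
  -- 0`, hence `e = 0`.
  obtain ⟨E, hEZ, hE, t, htZ, htn, htN⟩ := exists_badly_extensible hX Z hZc hZ (N + 1) (half_pos hδ)
  set V : Submodule 𝕜 X := E ⊔ LinearMap.range t.toLinearMap with hV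
  obtain ⟨C, hC⟩ := Submodule.exists_isCompl V
  have hCZ : ¬ FiniteDimensional 𝕜 ↥(C ⊓ Z) := by
    intro hfin
    have hVf : V.FG := Submodule.fg_iff_finiteDimensional _ |>.2 inferInstance
    have hC' : C.CoFG := Submodule.FG.cofg_of_isCompl hC hVf
    have h1 : (C ⊓ Z).CoFG := hC'.inf hZ
    exact hdim (Module.Finite.of_submodule_quotient (C ⊓ Z))
  obtain ⟨r₀, hr₀⟩ : ∃ r : (Fin (Module.finrank 𝕜 E) → 𝕜) →ₗ[𝕜] ↥(C ⊓ Z),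
      Function.Injective r := by
    rw [← Module.le_rank_iff_exists_linearMap]
    refine (Cardinal.natCast_lt_aleph0).le.trans ?_
    rw [← not_lt]
    exact fun h => hCZ (Module.rank_lt_aleph0_iff.1 h)
  let r : E →ₗ[𝕜] X := (C ⊓ Z).subtype ∘ₗ r₀ ∘ₗ (Module.finBasis 𝕜 E).equivFun.toLinearMap
  have hrCZ : ∀ e, r e ∈ C ⊓ Z := fun e => (r₀ _).2
  have hr : ∀ e, r e = 0 → e = 0 := by
    intro e he
    have h1 : r₀ ((Module.finBasis 𝕜 E).equivFun e) = 0 := Subtype.ext he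
    rw [← map_zero r₀] at h1
    simpa using hr₀ h1
  obtain ⟨R, hR⟩ := exists_continuousLinearMap_extension E r
  obtain ⟨η, hη, hη1, hη2⟩ : ∃ η : ℝ, 0 < η ∧ η * ‖R‖ ≤ 1 ∧ η * ‖R‖ ≤ δ / 2 := by
    have hm : 0 < min 1 (δ / 2) := lt_min one_pos (half_pos hδ)
    have hR1 : 0 < ‖R‖ + 1 := by positivity
    have hle : min 1 (δ / 2) / (‖R‖ + 1) * ‖R‖ ≤ min 1 (δ / 2) := by
      rw [div_mul_eq_mul_div, div_le_iff₀ hR1]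
      exact mul_le_mul_of_nonneg_left (by linarith) hm.le
    exact ⟨min 1 (δ / 2) / (‖R‖ + 1), div_pos hm hR1, hle.trans (min_le_left _ _),
      hle.trans (min_le_right _ _)⟩
  have hηR : ‖(η : 𝕜) • R‖ = η * ‖R‖ := by
    rw [norm_smul, RCLike.norm_ofReal, abs_of_pos hη]
  have hval : ∀ e : E, (t + ((η : 𝕜) • R).comp E.subtypeL) e = t e + (η : 𝕜) • r e := fun e => by
    simp [hR]
  refine ⟨E, hEZ, hE, t + ((η : 𝕜) • R).comp E.subtypeL, fun e => ?_, ?_, fun e he => ?_,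
    fun T hT => ?_⟩
  · rw [hval]
    exact Z.add_mem (htZ e) (Z.smul_mem _ (hrCZ e).2)
  · have h1 : ‖((η : 𝕜) • R).comp E.subtypeL‖ ≤ ‖(η : 𝕜) • R‖ :=
      ContinuousLinearMap.opNorm_le_bound _ (norm_nonneg _) fun x => ((η : 𝕜) • R).le_opNorm x
    have h2 := norm_add_le t (((η : 𝕜) • R).comp E.subtypeL)
    linarith
  · rw [hval] at he
    have h1 : (η : 𝕜) • r e ∈ V := by
      have := V.sub_mem ((le_sup_left : E ≤ V) he)
        ((le_sup_right : LinearMap.range t.toLinearMap ≤ V) ⟨e, rfl⟩)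
      rw [ContinuousLinearMap.coe_coe] at this
      rwa [add_sub_cancel_left] at this
    have h2 : (η : 𝕜) • r e = 0 :=
      Submodule.disjoint_def.1 hC.disjoint _ h1 (C.smul_mem _ (hrCZ e).1)
    have h3 : r e = 0 := (smul_eq_zero.1 h2).resolve_left (by exact_mod_cast hη.ne')
    rw [hr e h3, map_zero]
  · have h1 := htN (T - (η : 𝕜) • R) fun e => by
      rw [sub_apply, hT, hval, smul_apply, hR,
        add_sub_cancel_right]
    have h2 := norm_sub_le T ((η : 𝕜) • R)
    linarith

/-- Mazur's lemma: a finite-dimensional subspace is well complemented, at small cost, by a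
subspace of finite codimension. -/
theorem exists_cofg_norm_le_two_mul (W : Submodule 𝕜 X) [FiniteDimensional 𝕜 W] :
    ∃ Z : Submodule 𝕜 X, IsClosed (Z : Set X) ∧ Z.CoFG ∧
      ∀ w ∈ W, ∀ z ∈ Z, ‖w‖ ≤ 2 * ‖w + z‖ := by
  have : ProperSpace W := FiniteDimensional.proper 𝕜 W
  obtain ⟨s, hs, hsf, hcov⟩ := (isCompact_sphere (0 : W) 1).finite_cover_balls
    (e := 1 / 2) (by norm_num)
  have := hsf.fintype
  choose g hg1 hgx using fun x : X => exists_dual_vector'' 𝕜 x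
  let Φ : X →L[𝕜] (s → 𝕜) := ContinuousLinearMap.pi fun x => g ((x : W) : X)
  -- The common kernel of norming functionals for a finite `1/2`-net of the unit sphere of `W`: each
  -- unit vector of `W` is seen with modulus at least `1/2` by one of them.
  refine ⟨LinearMap.ker Φ.toLinearMap, Φ.isClosed_ker, Submodule.CoFG.ker _, fun w hw z hz => ?_⟩
  by_cases hw0 : w = 0
  · subst hw0
    simp
  have hpos : 0 < ‖w‖ := norm_pos_iff.2 hw0
  let u : W := ((‖w‖⁻¹ : ℝ) : 𝕜) • ⟨w, hw⟩
  have hwu : w = (‖w‖ : 𝕜) • (u : X) := by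
    simp only [u, Submodule.coe_smul, smul_smul, ← RCLike.ofReal_mul]
    rw [mul_inv_cancel₀ hpos.ne', RCLike.ofReal_one, one_smul]
  have hu : u ∈ Metric.sphere (0 : W) 1 := by
    rw [mem_sphere_zero_iff_norm]
    simp only [u, norm_smul, RCLike.norm_ofReal, abs_of_pos (inv_pos.2 hpos)]
    exact inv_mul_cancel₀ hpos.ne'
  obtain ⟨x, hxs, hxu⟩ := Set.mem_iUnion₂.1 (hcov hu)
  have hx1 : ‖(x : X)‖ = 1 := mem_sphere_zero_iff_norm.1 (hs hxs)
  rw [Metric.mem_ball, dist_eq_norm] at hxu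
  have hgz : g x z = 0 := congrFun (hz : Φ z = 0) ⟨x, hxs⟩
  have h1 : ‖g x (w + z)‖ ≤ ‖w + z‖ := by
    simpa using (g x).le_of_opNorm_le (hg1 x) (w + z)
  have h2 : g x (w + z) = (‖w‖ : 𝕜) * g x (u : X) := by
    rw [map_add, hgz, add_zero]
    conv_lhs => rw [hwu]
    simp
  have h3 : 1 / 2 ≤ ‖g x (u : X)‖ := by
    have h4 : ‖g x ((u : X) - x)‖ ≤ ‖u - x‖ := by
      simpa using (g x).le_of_opNorm_le (hg1 x) ((u : X) - x)
    have h5 : g x (x : X) = g x (u : X) - g x ((u : X) - x) := by simp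
    have h6 : ‖g x (x : X)‖ = 1 := by rw [hgx, hx1]; simp
    have h7 := norm_sub_le (g x (u : X)) (g x ((u : X) - x))
    rw [← h5, h6] at h7
    linarith
  rw [h2, norm_mul, RCLike.norm_ofReal, abs_of_pos hpos] at h1
  nlinarith

end Extension

/-! ### Inductive construction of the blocks. -/

section Construction

variable {𝕜 : Type*} [RCLike 𝕜] {X : Type*} [NormedAddCommGroup X] [NormedSpace 𝕜 X]

/-- There is a bounded projection onto a finite-dimensional subspace vanishing on a given disjoint
finite-dimensional subspace. -/
theorem exists_continuous_projection_of_disjoint {E V : Submodule 𝕜 X} [FiniteDimensional 𝕜 E]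
    [FiniteDimensional 𝕜 V] (h : Disjoint E V) :
    ∃ p : X →L[𝕜] E, (∀ e : E, p e = e) ∧ ∀ v ∈ V, p v = 0 := by
  obtain ⟨g, hg⟩ := LinearMap.exists_leftInverse_of_injective (V.mkQ ∘ₗ E.subtype) (by
    rw [LinearMap.ker_eq_bot']
    intro e he
    exact Subtype.ext (Submodule.disjoint_def.1 h _ e.2
      ((Submodule.Quotient.mk_eq_zero V).1 he)))
  obtain ⟨p, hp⟩ := exists_continuousLinearMap_extension (E ⊔ V)
    ((g ∘ₗ V.mkQ) ∘ₗ (E ⊔ V).subtype)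
  refine ⟨p, fun e => ?_, fun v hv => ?_⟩
  · rw [show p e = p (⟨e, (le_sup_left : E ≤ E ⊔ V) e.2⟩ : ↥(E ⊔ V)) from rfl, hp]
    exact DFunLike.congr_fun hg e
  · rw [show p v = p (⟨v, (le_sup_right : V ≤ E ⊔ V) hv⟩ : ↥(E ⊔ V)) from rfl, hp]
    change g (V.mkQ v) = 0
    rw [show V.mkQ v = 0 from (Submodule.Quotient.mk_eq_zero V).2 hv, map_zero]

variable (𝕜 X) in
/-- A finite-dimensional subspace together with a closed subspace of finite codimension which is
almost orthogonal to it. -/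
structure AlmostOrthogonalPair where
  fin : Submodule 𝕜 X
  cofin : Submodule 𝕜 X
  finiteDimensional_fin : FiniteDimensional 𝕜 fin
  isClosed_cofin : IsClosed (cofin : Set X)
  cofg_cofin : cofin.CoFG
  norm_le : ∀ w ∈ fin, ∀ z ∈ cofin, ‖w‖ ≤ 2 * ‖w + z‖

/-- One block of the construction: between the pairs `s` and `s'` there is a subspace `E` and a
finite-rank operator `S` that is small on `E` but has no small extension from `E`. -/
structure IsBlock (N δ : ℝ) (s s' : AlmostOrthogonalPair 𝕜 X) (E : Submodule 𝕜 X)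
    (S : X →L[𝕜] X) : Prop where
  fin_le : s.fin ≤ s'.fin
  cofin_le : s'.cofin ≤ s.cofin
  le_cofin : E ≤ s.cofin
  le_fin : E ≤ s'.fin
  apply_mem_fin : ∀ x, S x ∈ s'.fin
  apply_mem_cofin : ∀ x, S x ∈ s.cofin
  apply_fin : ∀ x ∈ s.fin, S x = 0
  apply_cofin : ∀ x ∈ s'.cofin, S x = 0
  apply_apply : ∀ x, S (S x) = 0
  isCompact : IsCompactOperator S
  norm_apply_le : ∀ e ∈ E, ‖S e‖ ≤ δ * ‖e‖
  le_norm : ∀ T : X →L[𝕜] X, (∀ e ∈ E, T e = S e) → N ≤ ‖T‖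

/-- A badly extensible `t` on `E` becomes `S = t ∘ p`, where `p` projects onto `E` and kills both
the old finite-dimensional space and the range of `t`; the latter gives `S² = 0`. The new cofinite
space is taken inside `ker S`. -/
theorem exists_isBlock (hdim : ¬ FiniteDimensional 𝕜 X) (hX : ¬ IsUFO 𝕜 X) (N : ℝ) {δ : ℝ}
    (hδ : 0 < δ) (s : AlmostOrthogonalPair 𝕜 X) :
    ∃ (s' : AlmostOrthogonalPair 𝕜 X) (E : Submodule 𝕜 X) (S : X →L[𝕜] X),
      IsBlock N δ s s' E S := by
  obtain ⟨W, Z, hW, hZc, hZ, hWZ⟩ := s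
  obtain ⟨E, hEZ, hE, t, htZ, htn, hdisj, htN⟩ :=
    exists_badly_extensible_disjoint hdim hX Z hZc hZ N hδ
  set R : Submodule 𝕜 X := LinearMap.range t.toLinearMap with hR
  have htR : ∀ e, t e ∈ R := fun e => ⟨e, rfl⟩
  have hEWR : Disjoint E (W ⊔ R) := by
    rw [Submodule.disjoint_def]
    intro x hxE hx
    obtain ⟨w, hw, _, ⟨e, rfl⟩, hwe⟩ := Submodule.mem_sup.1 hx
    rw [ContinuousLinearMap.coe_coe] at hwe
    have h1 : w = x - t e := by rw [← hwe]; abel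
    have h2 : w ∈ Z := by rw [h1]; exact Z.sub_mem (hEZ hxE) (htZ e)
    have h3 : w = 0 := by
      have := hWZ w hw (-w) (Z.neg_mem h2)
      rw [add_neg_cancel, norm_zero, mul_zero] at this
      exact norm_le_zero_iff.1 this
    rw [h3, zero_add] at hwe
    rw [← hwe]
    exact hdisj e (hwe ▸ hxE)
  obtain ⟨p, hpE, hp0⟩ := exists_continuous_projection_of_disjoint hEWR
  set S : X →L[𝕜] X := t.comp p with hS
  have hSE : ∀ e : E, S e = t e := fun e => by rw [hS, ContinuousLinearMap.comp_apply, hpE]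
  have hS0 : ∀ x ∈ W ⊔ R, S x = 0 := fun x hx => by
    rw [hS, ContinuousLinearMap.comp_apply, hp0 x hx, map_zero]
  have hSR : ∀ x, S x ∈ R := fun x => htR _
  obtain ⟨Z₁, hZ₁c, hZ₁, hZ₁n⟩ := exists_cofg_norm_le_two_mul (W ⊔ (E ⊔ R))
  have hker : (LinearMap.ker S.toLinearMap).CoFG := by
    refine Submodule.CoFG.of_le (S := LinearMap.ker p.toLinearMap) ?_ (Submodule.CoFG.ker _)
    intro x hx
    have : p x = 0 := hx
    change t (p x) = 0
    rw [this, map_zero]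
  refine ⟨⟨W ⊔ (E ⊔ R), Z ⊓ (LinearMap.ker S.toLinearMap ⊓ Z₁), inferInstance,
    hZc.inter (S.isClosed_ker.inter hZ₁c), hZ.inf (hker.inf hZ₁),
    fun w hw z hz => hZ₁n w hw z hz.2.2⟩, E, S, ?_⟩
  refine ⟨le_sup_left, inf_le_left, hEZ, le_sup_left.trans le_sup_right,
    fun x => (le_sup_right.trans le_sup_right : R ≤ W ⊔ (E ⊔ R)) (hSR x), fun x => htZ _,
    fun x hx => hS0 x ((le_sup_left : W ≤ W ⊔ R) hx), fun x hx => hx.2.1,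
    fun x => hS0 _ ((le_sup_right : R ≤ W ⊔ R) (hSR x)), ?_, fun e he => ?_, fun T hT => ?_⟩
  · have : ProperSpace E := FiniteDimensional.proper 𝕜 E
    have hid : IsCompactOperator (id : E → E) :=
      ⟨Metric.closedBall 0 1, isCompact_closedBall _ _,
        by simpa using Metric.closedBall_mem_nhds (0 : E) one_pos⟩
    exact (hid.clm_comp t).comp_clm p
  · rw [hSE ⟨e, he⟩]
    exact t.le_of_opNorm_le htn _
  · exact htN T fun e => by rw [hT e e.2, hSE]

/-- Operators `S n` of square zero, annihilating each other, which are summably small on `Y` while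
the restriction of `S n` to a subspace `E n` of `Y` has no small extension. -/
structure IsBlockSystem (Y : Submodule 𝕜 X) (E : ℕ → Submodule 𝕜 X) (S : ℕ → X →L[𝕜] X) :
    Prop where
  comp_eq_zero : ∀ n k x, S n (S k x) = 0
  norm_apply_le : ∀ n, ∀ y ∈ Y, ‖S n y‖ ≤ 1 / 2 / 2 ^ n * ‖y‖
  isCompact : ∀ n, IsCompactOperator (S n)
  le : ∀ n, E n ≤ Y
  apply_eq_zero : ∀ n k, n ≠ k → ∀ e ∈ E n, S k e = 0
  le_norm : ∀ n, ∀ T : X →L[𝕜] X, (∀ e ∈ E n, T e = S n e) → 2 ^ n ≤ ‖T‖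

theorem exists_isBlockSystem (hdim : ¬ FiniteDimensional 𝕜 X) (hX : ¬ IsUFO 𝕜 X) :
    ∃ (Y : Submodule 𝕜 X) (E : ℕ → Submodule 𝕜 X) (S : ℕ → X →L[𝕜] X),
      IsClosed (Y : Set X) ∧ IsBlockSystem Y E S := by
  have hδ : ∀ n : ℕ, (0 : ℝ) < 1 / 8 / 2 ^ n := fun n => by positivity
  choose next E' S' hblock using fun n : ℕ => exists_isBlock hdim hX (2 ^ n) (hδ n)
  let s : ℕ → AlmostOrthogonalPair 𝕜 X := fun n => Nat.rec
    ⟨⊥, ⊤, inferInstance, isClosed_univ, Submodule.CoFG.top, fun w hw z _ => by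
      rw [(Submodule.mem_bot 𝕜).1 hw, norm_zero]; positivity⟩ (fun n s => next n s) n
  let E : ℕ → Submodule 𝕜 X := fun n => E' n (s n)
  let S : ℕ → X →L[𝕜] X := fun n => S' n (s n)
  have hb : ∀ n, IsBlock (2 ^ n) (1 / 8 / 2 ^ n) (s n) (s (n + 1)) (E n) (S n) :=
    fun n => hblock n (s n)
  have hfin : Monotone fun n => (s n).fin := monotone_nat_of_le_succ fun n => (hb n).fin_le
  have hcofin : Antitone fun n => (s n).cofin := antitone_nat_of_succ_le fun n => (hb n).cofin_le
  have hbound : ∀ n, ∀ y ∈ ⨆ k, E k, ‖S n y‖ ≤ 1 / 2 / 2 ^ n * ‖y‖ := by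
    intro n y hy
    -- Only the `E n` component of `y` is seen by `S n`. Two uses of almost orthogonality bound it
    -- by `4‖y‖`, which turns `1/8` into `1/2`.
    have hle : (⨆ k, E k) ≤ (s n).fin ⊔ (E n ⊔ (s (n + 1)).cofin) := by
      refine iSup_le fun k => ?_
      rcases lt_trichotomy k n with h | rfl | h
      · exact ((hb k).le_fin.trans (hfin h)).trans le_sup_left
      · exact le_sup_left.trans le_sup_right
      · exact ((hb k).le_cofin.trans (hcofin h)).trans (le_sup_right.trans le_sup_right)
    obtain ⟨w, hw, _, hez, rfl⟩ := Submodule.mem_sup.1 (hle hy)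
    obtain ⟨e, he, z, hz, rfl⟩ := Submodule.mem_sup.1 hez
    have h1 := (s n).norm_le w hw (e + z)
      ((s n).cofin.add_mem ((hb n).le_cofin he) ((hb n).cofin_le hz))
    have h2 := (s (n + 1)).norm_le (w + e)
      ((s (n + 1)).fin.add_mem ((hb n).fin_le hw) ((hb n).le_fin he)) z hz
    rw [add_assoc] at h2
    have h3 : ‖e‖ ≤ 4 * ‖w + (e + z)‖ := by
      have := norm_sub_le (w + e) w
      rw [add_sub_cancel_left] at this
      linarith
    rw [map_add, map_add, (hb n).apply_fin w hw, (hb n).apply_cofin z hz, zero_add, add_zero]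
    calc ‖S n e‖ ≤ 1 / 8 / 2 ^ n * ‖e‖ := (hb n).norm_apply_le e he
      _ ≤ 1 / 8 / 2 ^ n * (4 * ‖w + (e + z)‖) := mul_le_mul_of_nonneg_left h3 (hδ n).le
      _ = 1 / 2 / 2 ^ n * ‖w + (e + z)‖ := by ring
  refine ⟨(⨆ k, E k).topologicalClosure, E, S, Submodule.isClosed_topologicalClosure _,
    fun n k x => ?_, fun n y hy => ?_, fun n => (hb n).isCompact,
    fun n => (le_iSup E n).trans (Submodule.le_topologicalClosure _), fun n k hnk e he => ?_,
    fun n => (hb n).le_norm⟩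
  · rcases lt_trichotomy n k with h | rfl | h
    · exact (hb n).apply_cofin _ (hcofin h ((hb k).apply_mem_cofin x))
    · exact (hb n).apply_apply x
    · exact (hb n).apply_fin _ (hfin h ((hb k).apply_mem_fin x))
  · have hcl : IsClosed {y : X | ‖S n y‖ ≤ 1 / 2 / 2 ^ n * ‖y‖} :=
      isClosed_le (by fun_prop) (by fun_prop)
    exact hcl.closure_subset_iff.2 (hbound n) hy
  · rcases lt_or_gt_of_ne hnk with h | h
    · exact (hb k).apply_fin e (hfin h ((hb n).le_fin he))
    · exact (hb k).apply_cofin e (hcofin h ((hb n).le_cofin he))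

end Construction

/-! ### Non-smoothness of `E₀`. -/

open MeasureTheory ProbabilityTheory Filter in
/-- A Borel set invariant under eventual agreement has measure `0` or `1`. -/
theorem measure_zero_or_one_of_relE0_invariant (μ : Measure (ℕ → Bool)) [IsProbabilityMeasure μ]
    (hμ : iIndepFun (fun (n : ℕ) (α : ℕ → Bool) => α n) μ) {s : Set (ℕ → Bool)}
    (hs : MeasurableSet s) (hinv : ∀ α β, relE0 α β → (α ∈ s ↔ β ∈ s)) :
    μ s = 0 ∨ μ s = 1 := by
  refine measure_zero_or_one_of_measurableSet_limsup_atTop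
    (s := fun n => MeasurableSpace.comap (fun α : ℕ → Bool => α n) inferInstance)
    (fun n => (measurable_pi_apply n).comap_le) hμ ?_
  rw [limsup_eq_iInf_iSup_of_nat, MeasurableSpace.measurableSet_iInf]
  intro n
  -- Erasing the first `n` coordinates does not change membership in `s`, so `s` is a tail event and
  -- Kolmogorov's law applies.
  let z : (ℕ → Bool) → (ℕ → Bool) := fun α k => if n ≤ k then α k else false
  have hz : s = z ⁻¹' s := by
    ext α
    exact hinv _ _ ⟨n, fun k hk => by simp [z, hk]⟩
  rw [hz]
  have hzm : @Measurable _ _ (⨆ i, ⨆ (_ : i ≥ n),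
      MeasurableSpace.comap (fun α : ℕ → Bool => α i) inferInstance) _ z := by
    refine @measurable_pi_lambda _ _ _ (_) _ _ fun k => ?_
    by_cases hk : n ≤ k
    · simp only [z, hk, if_true]
      exact (comap_measurable _).mono (le_iSup₂_of_le k hk le_rfl) le_rfl
    · simp only [z, hk, if_false]
      exact @measurable_const _ _ _ (_) _
  exact hzm hs

-- By the zero-one law a reduction to equality is almost surely constant for the fair coin measure.
-- Flipping all bits preserves this measure, so some `α` and its flip have the same image, although
-- they agree nowhere.
open MeasureTheory ProbabilityTheory Filter in
theorem not_isSmoothRel_relE0 : ¬ IsSmoothRel relE0 := by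
  rintro ⟨f, hf, hred⟩
  let ν : Measure Bool := (2⁻¹ : ENNReal) • (Measure.dirac false + Measure.dirac true)
  have : IsProbabilityMeasure ν := ⟨by
    simp [ν, ENNReal.inv_two_add_inv_two]⟩
  have hflip : ν.map not = ν := by
    simp only [ν, Measure.map_smul]
    rw [Measure.map_add _ _ (by fun_prop), Measure.map_dirac, Measure.map_dirac, add_comm]
    rfl
  let μ : Measure (ℕ → Bool) := Measure.infinitePi fun _ => ν
  have hμflip : μ.map (fun α n => !(α n)) = μ := by
    have := Measure.infinitePi_map_pi (μ := fun _ : ℕ => ν) (f := fun _ => not) (by fun_prop)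
    simpa [hflip, μ] using this
  have hind : iIndepFun (fun (n : ℕ) (α : ℕ → Bool) => α n) μ :=
    iIndepFun_infinitePi (X := fun _ b => b) (by fun_prop)
  have h01 := fun s hs h => measure_zero_or_one_of_relE0_invariant μ hind (s := s) hs h
  obtain ⟨c, hc⟩ := exists_eventuallyEq_const_of_forall_separating (l := ae μ) (f := f)
    (p := MeasurableSet) (by
      intro U hU
      have := h01 (f ⁻¹' U) (hf hU) (fun α β h => by
        have : f α = f β := (hred α β).1 h
        simp [this])
      rcases this with h | h
      · right
        rw [measure_eq_zero_iff_ae_notMem] at h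
        exact h
      · left
        exact (mem_ae_iff_prob_eq_one (hf hU)).2 h)
  have hc' : ∀ᵐ α ∂μ, f (fun n => !(α n)) = c := by
    have : ∀ᵐ α ∂(μ.map (fun α n => !(α n))), f α = c := by rw [hμflip]; exact hc
    exact ae_of_ae_map (measurable_pi_lambda _ fun n =>
      (measurable_of_countable not).comp (measurable_pi_apply n)).aemeasurable this
  obtain ⟨α, h1, h2⟩ := (hc.and hc').exists
  obtain ⟨m, hm⟩ := (hred α (fun n => !(α n))).2 (h1.trans h2.symm)
  simpa using hm m le_rfl

/-! ### Block sums and the embeddings they define. -/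

section Positions

variable {𝕜 : Type*} [RCLike 𝕜] {X : Type*} [NormedAddCommGroup X] [NormedSpace 𝕜 X]

/-- The operator `∑ c n • S n` on `Y`, for a `0`-`1` sequence `c`. -/
noncomputable def blockSum (Y : Submodule 𝕜 X) (S : ℕ → X →L[𝕜] X) (c : ℕ → Bool) : Y →L[𝕜] X :=
  ∑' n, if c n then (S n).comp Y.subtypeL else 0

/-- The finite part `∑_{n < k} (d n - c n) • S n` of the difference of two block sums. -/
noncomputable def blockDiff (S : ℕ → X →L[𝕜] X) (k : ℕ) (c d : ℕ → Bool) : X →L[𝕜] X :=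
  ∑ n ∈ Finset.range k, ((if d n then S n else 0) - if c n then S n else 0)

theorem norm_blockDiff_le (S : ℕ → X →L[𝕜] X) (k : ℕ) (c d : ℕ → Bool) :
    ‖blockDiff S k c d‖ ≤ ∑ n ∈ Finset.range k, ‖S n‖ := by
  refine norm_sum_le_of_le _ fun n _ => ?_
  cases c n <;> cases d n <;> simp

namespace IsBlockSystem

variable {Y : Submodule 𝕜 X} {E : ℕ → Submodule 𝕜 X} {S : ℕ → X →L[𝕜] X}

theorem norm_comp_le (h : IsBlockSystem Y E S) (n : ℕ) :
    ‖(S n).comp Y.subtypeL‖ ≤ 1 / 2 / 2 ^ n :=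
  ContinuousLinearMap.opNorm_le_bound _ (by positivity) fun y => h.norm_apply_le n y y.2

theorem norm_term_le (h : IsBlockSystem Y E S) (c : ℕ → Bool) (n : ℕ) :
    ‖if c n then (S n).comp Y.subtypeL else 0‖ ≤ 1 / 2 / 2 ^ n := by
  split_ifs
  · exact h.norm_comp_le n
  · rw [norm_zero]; positivity

/-- A bounded projection onto `Y` would extend every `S n` from `E n` with uniformly bounded norm.
-/
theorem not_finiteDimensional (h : IsBlockSystem Y E S) : ¬ FiniteDimensional 𝕜 Y := by
  intro hY
  obtain ⟨p, hp⟩ := Submodule.ClosedComplemented.of_finiteDimensional Y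
  obtain ⟨n, hn⟩ := pow_unbounded_of_one_lt ‖p‖ (one_lt_two : (1 : ℝ) < 2)
  have h1 := h.le_norm n (((S n).comp Y.subtypeL).comp p) fun e he => by
    simp [hp ⟨e, h.le n he⟩]
  have h2 : ‖((S n).comp Y.subtypeL).comp p‖ ≤ 1 / 2 / 2 ^ n * ‖p‖ :=
    (ContinuousLinearMap.opNorm_comp_le _ _).trans
      (mul_le_mul_of_nonneg_right (h.norm_comp_le n) (norm_nonneg _))
  have h3 : (1 : ℝ) / 2 / 2 ^ n ≤ 1 := by
    rw [div_le_one (by positivity)]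
    linarith [one_le_pow₀ (one_le_two : (1 : ℝ) ≤ 2) (n := n)]
  have := mul_le_mul_of_nonneg_right h3 (norm_nonneg p)
  linarith

/-- The bounds `1 / 2 / 2 ^ n` add up to exactly `1`. Completeness is not needed: a divergent series
has `tsum` equal to `0`. -/
theorem norm_blockSum_le (h : IsBlockSystem Y E S) (c : ℕ → Bool) : ‖blockSum Y S c‖ ≤ 1 :=
  tsum_of_norm_bounded (hasSum_geometric_two' 1) (h.norm_term_le c)

theorem blockDiff_apply_apply (h : IsBlockSystem Y E S) (k : ℕ) (c d : ℕ → Bool) (x : X) :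
    blockDiff S k c d (blockDiff S k c d x) = 0 := by
  have key : ∀ n, S n (blockDiff S k c d x) = 0 := fun n => by
    simp only [blockDiff, sum_apply, map_sum]
    refine Finset.sum_eq_zero fun j _ => ?_
    cases c j <;> cases d j <;> simp [h.comp_eq_zero]
  generalize blockDiff S k c d x = z at key
  rw [blockDiff, sum_apply]
  refine Finset.sum_eq_zero fun j _ => ?_
  cases c j <;> cases d j <;> simp [key]

/-- The perturbed inclusion `y ↦ y + ε • ∑ c n • S n y` is bounded below. -/
theorem le_norm_perturbation (h : IsBlockSystem Y E S) {ε : ℝ} (hε : 0 < ε) (c : ℕ → Bool) (y : Y) :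
    (1 - ε) * ‖y‖ ≤ ‖(Y.subtypeL + (ε : 𝕜) • blockSum Y S c) y‖ := by
  have h1 : ‖(ε : 𝕜) • blockSum Y S c y‖ ≤ ε * ‖y‖ := by
    rw [norm_smul, RCLike.norm_ofReal, abs_of_pos hε]
    refine mul_le_mul_of_nonneg_left ?_ hε.le
    simpa using (blockSum Y S c).le_of_opNorm_le (h.norm_blockSum_le c) y
  have h2 := norm_sub_norm_le (y : X) (-((ε : 𝕜) • blockSum Y S c y))
  rw [norm_neg, sub_neg_eq_add] at h2
  change _ ≤ ‖(y : X) + (ε : 𝕜) • blockSum Y S c y‖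
  rw [Submodule.coe_norm] at *
  linarith

variable [CompleteSpace X]

theorem hasSum_blockSum (h : IsBlockSystem Y E S) (c : ℕ → Bool) :
    HasSum (fun n => if c n then (S n).comp Y.subtypeL else 0) (blockSum Y S c) :=
  (Summable.of_norm_bounded (hasSum_geometric_two' 1).summable (h.norm_term_le c)).hasSum

theorem hasSum_blockSum_apply (h : IsBlockSystem Y E S) (c : ℕ → Bool) (y : Y) :
    HasSum (fun n => if c n then S n y else 0) (blockSum Y S c y) := by
  have := (h.hasSum_blockSum c).mapL (ContinuousLinearMap.apply 𝕜 X y)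
  convert this using 2 with n
  · split_ifs <;> rfl
  · rfl

theorem isCompactOperator_blockSum (h : IsBlockSystem Y E S) (c : ℕ → Bool) :
    IsCompactOperator (blockSum Y S c) := by
  refine isCompactOperator_of_tendsto (h.hasSum_blockSum c) (Filter.Eventually.of_forall fun s => ?_)
  refine Submodule.sum_mem (compactOperator (RingHom.id 𝕜) Y X) fun n _ => ?_
  split_ifs
  · exact (h.isCompact n).comp_clm Y.subtypeL
  · exact Submodule.zero_mem _

theorem continuous_blockSum (h : IsBlockSystem Y E S) : Continuous (blockSum Y S) := by
  refine continuous_tsum (fun n => ?_) (hasSum_geometric_two' 1).summable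
    fun n c => h.norm_term_le c n
  exact (continuous_of_discreteTopology (f := fun b : Bool =>
    if b then (S n).comp Y.subtypeL else 0)).comp (continuous_apply n)

theorem blockSum_apply (h : IsBlockSystem Y E S) (c : ℕ → Bool) (n : ℕ) {e : Y}
    (he : (e : X) ∈ E n) : blockSum Y S c e = if c n then S n e else 0 := by
  refine (h.hasSum_blockSum_apply c e).unique ?_
  refine hasSum_single n fun k hk => ?_
  rw [h.apply_eq_zero n k hk.symm e he, ite_self]

theorem apply_blockSum (h : IsBlockSystem Y E S) (c : ℕ → Bool) (k : ℕ) (y : Y) :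
    S k (blockSum Y S c y) = 0 := by
  refine ((h.hasSum_blockSum_apply c y).mapL (S k)).unique ?_
  convert hasSum_zero with n
  split_ifs
  · exact h.comp_eq_zero k n y
  · exact map_zero _

theorem blockDiff_apply_blockSum (h : IsBlockSystem Y E S) (k : ℕ) (c d a : ℕ → Bool) (y : Y) :
    blockDiff S k c d (blockSum Y S a y) = 0 := by
  rw [blockDiff, sum_apply]
  refine Finset.sum_eq_zero fun j _ => ?_
  cases c j <;> cases d j <;> simp [h.apply_blockSum]

theorem blockSum_add_blockDiff (h : IsBlockSystem Y E S) {k : ℕ} {c d : ℕ → Bool}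
    (hcd : AgreeFrom k c d) (y : Y) :
    blockSum Y S c y + blockDiff S k c d y = blockSum Y S d y := by
  rw [← eq_sub_iff_add_eq']
  have h1 := (h.hasSum_blockSum_apply d y).sub (h.hasSum_blockSum_apply c y)
  have h2 : HasSum (fun n => (if d n then S n y else 0) - if c n then S n y else 0)
      (∑ n ∈ Finset.range k, ((if d n then S n (y : X) else 0) - if c n then S n y else 0)) := by
    refine hasSum_sum_of_ne_finset_zero fun n hn => ?_
    rw [hcd n (by simpa using hn), sub_self]
  rw [h1.unique h2, blockDiff, sum_apply]
  refine Finset.sum_congr rfl fun n _ => ?_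
  cases c n <;> cases d n <;> simp

/-- A range of finite codimension would be complemented, giving a bounded left inverse `L`. Where `c
n = 0` the embedding is the identity on `E n`, so the block sum of the complementary sequence
composed with `L` would extend `S n` from `E n` for infinitely many `n`. -/
theorem not_cofg_range_perturbation (h : IsBlockSystem Y E S) (hY : IsClosed (Y : Set X)) {ε : ℝ}
    (hε : 0 < ε) (hε1 : ε < 1) {c : ℕ → Bool} (hc : ∀ m, ∃ n, m ≤ n ∧ c n = false) :
    ¬ FiniteDimensional 𝕜
      (X ⧸ LinearMap.range (Y.subtypeL + (ε : 𝕜) • blockSum Y S c).toLinearMap) := by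
  intro hfin
  have : CompleteSpace Y := hY.completeSpace_coe
  set A := Y.subtypeL + (ε : 𝕜) • blockSum Y S c with hA
  have hanti : AntilipschitzWith (1 - ε).toNNReal⁻¹ A := by
    refine A.antilipschitz_of_bound fun y => ?_
    rw [NNReal.coe_inv, Real.coe_toNNReal _ (by linarith), inv_mul_eq_div,
      le_div_iff₀ (by linarith), mul_comm]
    exact h.le_norm_perturbation hε c y
  have hcl : IsClosed (Set.range A) := hanti.isClosed_range A.uniformContinuous
  have hcl' : IsClosed (LinearMap.range A.toLinearMap : Set X) := by
    rwa [LinearMap.coe_range]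
  obtain ⟨L, hL⟩ := open ContinuousLinearMap.HasLeftInverse in
    of_injective_of_isClosed_range_of_closedComplement_range
    hanti.injective hcl (Submodule.ClosedComplemented.of_finiteDimensional_quotient hcl')
  let τ : X →L[𝕜] X := (blockSum Y S fun n => !(c n)).comp L
  obtain ⟨m, hm⟩ := pow_unbounded_of_one_lt ‖τ‖ (one_lt_two : (1 : ℝ) < 2)
  obtain ⟨n, hmn, hn⟩ := hc m
  have h1 : 2 ^ n ≤ ‖τ‖ := h.le_norm n τ fun e he => by
    have he' : A ⟨e, h.le n he⟩ = e := by
      simp [hA, h.blockSum_apply c n (e := ⟨e, h.le n he⟩) he, hn]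
    change blockSum Y S _ (L e) = _
    conv_lhs => rw [← he']
    rw [hL, h.blockSum_apply _ n (e := ⟨e, h.le n he⟩) he, hn]
    rfl
  have h2 : (2 : ℝ) ^ m ≤ 2 ^ n := pow_le_pow_right₀ (by norm_num) hmn
  linarith

theorem le_norm_of_perturbation (h : IsBlockSystem Y E S) {ε : ℝ} (hε : 0 < ε) {c d : ℕ → Bool}
    {n : ℕ} (hc : c n = false) (hd : d n = true) (τ : X →L[𝕜] X)
    (hτ : ∀ y : Y, τ ((Y.subtypeL + (ε : 𝕜) • blockSum Y S c) y) =
      (Y.subtypeL + (ε : 𝕜) • blockSum Y S d) y) :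
    ε * 2 ^ n - 1 ≤ ‖τ‖ := by
  have hε' : (ε : 𝕜) ≠ 0 := by exact_mod_cast hε.ne'
  have h1 := h.le_norm n ((ε : 𝕜)⁻¹ • (τ - ContinuousLinearMap.id 𝕜 X)) fun e he => by
    have h2 := hτ ⟨e, h.le n he⟩
    simp only [add_apply, smul_apply, h.blockSum_apply _ n (e := ⟨e, h.le n he⟩) he, hc, hd,
      Submodule.subtypeL_apply, if_true, Bool.false_eq_true, if_false, smul_zero, add_zero] at h2
    simp [h2, smul_smul, inv_mul_cancel₀ hε']
  rw [norm_smul, norm_inv, RCLike.norm_ofReal, abs_of_pos hε, inv_mul_eq_div,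
    le_div_iff₀ hε] at h1
  have h2 := norm_sub_le τ (ContinuousLinearMap.id 𝕜 X)
  have h3 := ContinuousLinearMap.norm_id_le (𝕜 := 𝕜) (E := X)
  linarith

/-- The automorphism `1 + ε • ∑_{n < k} (d n - c n) • S n`. -/
theorem exists_automorphism (h : IsBlockSystem Y E S) {ε : ℝ} (hε : 0 < ε) (hε1 : ε < 1) {k : ℕ}
    {c d : ℕ → Bool} (hcd : AgreeFrom k c d) :
    ∃ τ : X ≃L[𝕜] X, (∀ y : Y, τ ((Y.subtypeL + (ε : 𝕜) • blockSum Y S c) y) =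
      (Y.subtypeL + (ε : 𝕜) • blockSum Y S d) y) ∧
      max ‖(τ : X →L[𝕜] X)‖ ‖(τ.symm : X →L[𝕜] X)‖ ≤ 1 + ∑ n ∈ Finset.range k, ‖S n‖ := by
  let B : X →L[𝕜] X := (ε : 𝕜) • blockDiff S k c d
  have hBB : ∀ x, B (B x) = 0 := fun x => by
    simp [B, h.blockDiff_apply_apply]
  have hBn : ‖B‖ ≤ ∑ n ∈ Finset.range k, ‖S n‖ := by
    rw [norm_smul, RCLike.norm_ofReal, abs_of_pos hε]
    refine le_trans ?_ (norm_blockDiff_le S k c d)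
    exact mul_le_of_le_one_left (norm_nonneg _) hε1.le
  have hid := ContinuousLinearMap.norm_id_le (𝕜 := 𝕜) (E := X)
  -- `B² = 0` makes `1 - B` the inverse of `1 + B`. Since `B` kills every block sum, it acts only on
  -- the inclusion part of the embedding.
  refine ⟨ContinuousLinearEquiv.equivOfInverse (ContinuousLinearMap.id 𝕜 X + B)
    (ContinuousLinearMap.id 𝕜 X - B) (fun x => by simp [hBB]) (fun x => by simp [hBB]),
    fun y => ?_, max_le ?_ ?_⟩
  · change ((y : X) + (ε : 𝕜) • blockSum Y S c y) +
      (ε : 𝕜) • blockDiff S k c d ((y : X) + (ε : 𝕜) • blockSum Y S c y) =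
      (y : X) + (ε : 𝕜) • blockSum Y S d y
    rw [← h.blockSum_add_blockDiff hcd, map_add, map_smul, h.blockDiff_apply_blockSum, smul_zero,
      add_zero, smul_add, add_assoc]
  · change ‖ContinuousLinearMap.id 𝕜 X + B‖ ≤ _
    exact (norm_add_le _ _).trans (add_le_add hid hBn)
  · change ‖ContinuousLinearMap.id 𝕜 X - B‖ ≤ _
    exact (norm_sub_le _ _).trans (add_le_add hid hBn)

end IsBlockSystem

/-- The sequence `α` written on the even places, with zeros on the odd places. -/
def interleaveFalse (α : ℕ → Bool) (n : ℕ) : Bool :=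
  decide (n % 2 = 0) && α (n / 2)

theorem interleaveFalse_two_mul (α : ℕ → Bool) (n : ℕ) : interleaveFalse α (2 * n) = α n := by
  simp [interleaveFalse]

theorem continuous_interleaveFalse : Continuous interleaveFalse :=
  continuous_pi fun n => (continuous_of_discreteTopology (f := fun b : Bool =>
    decide (n % 2 = 0) && b)).comp (continuous_apply (n / 2))

theorem AgreeFrom.interleaveFalse {m : ℕ} {α β : ℕ → Bool} (h : AgreeFrom m α β) :
    AgreeFrom (2 * m) (interleaveFalse α) (interleaveFalse β) := by
  intro n hn
  simp only [_root_.interleaveFalse]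
  rw [h (n / 2) (by omega)]

theorem exists_interleaveFalse_eq_false (α : ℕ → Bool) (m : ℕ) :
    ∃ n, m ≤ n ∧ interleaveFalse α n = false :=
  ⟨2 * m + 1, by omega, by simp [interleaveFalse, Nat.add_mod]⟩

/-- The strong operator topology is coarser than the norm topology, so norm continuity suffices. -/
theorem Emb.measurable_of_continuous {Y : Type*} [NormedAddCommGroup Y] [NormedSpace 𝕜 Y]
    {f : (ℕ → Bool) → Emb 𝕜 Y X} (hf : Continuous fun α => (f α).toCLM) : Measurable f := by
  have hc : Continuous f := continuous_induced_rng.2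
    ((ContinuousLinearMap.toPointwiseConvergenceCLM 𝕜 (RingHom.id 𝕜) Y X).continuous.comp hf)
  have : BorelSpace (Emb 𝕜 Y X) := ⟨rfl⟩
  exact hc.measurable

end Positions

/-! ### Assembling the reduction. -/

theorem IsBorelReduction.not_isSmoothRel {E F : Type*} [MeasurableSpace E] [MeasurableSpace F]
    {R : Setoid E} {R' : Setoid F} {f : E → F} (hf : IsBorelReduction R R' f)
    (hR : ¬ IsSmoothRel R) : ¬ IsSmoothRel R' := by
  rintro ⟨g, hg, hgR⟩
  exact hR ⟨g ∘ f, hg.comp hf.1, fun x y => (hf.2 x y).trans (hgR _ _)⟩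

theorem theorem2 {𝕜 : Type*} [RCLike 𝕜] {X : Type*} [NormedAddCommGroup X] [NormedSpace 𝕜 X]
    [CompleteSpace X] [TopologicalSpace.SeparableSpace X]
    (hdim : ¬ FiniteDimensional 𝕜 X) (hX : ¬ IsUFO 𝕜 X) :
    ∃ Y : Submodule 𝕜 X, IsClosed (Y : Set X) ∧ ¬ FiniteDimensional 𝕜 Y ∧
      BorelReducible relE0 (Emb.position 𝕜 Y X) ∧
      ¬ IsSmoothRel (Emb.position 𝕜 Y X) ∧
      ∃ T : (ℕ → Bool) → (Y →L[𝕜] X),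
        (∀ α : ℕ → Bool, IsCompactOperator (T α) ∧ ‖T α‖ ≤ 1) ∧
        ∀ ε : ℝ, 0 < ε → ε < 1 →
          ∃ A : (ℕ → Bool) → Emb 𝕜 Y X,
            (∀ α : ℕ → Bool, (A α).toCLM = Y.subtypeL + (ε : 𝕜) • T α) ∧
            IsBorelReduction relE0 (Emb.position 𝕜 Y X) A ∧
            (∃ c : ℕ → ℕ, ∀ (m : ℕ) (α β : ℕ → Bool), AgreeFrom m α β →
              Emb.SamePositionWithin (c m : ℝ) (A α) (A β)) ∧
            (∀ (m n : ℕ) (α β : ℕ → Bool), m ≤ n → α n = false → β n = true →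
              ∀ τ : X →L[𝕜] X, (∀ y : Y, τ ((A α).toCLM y) = (A β).toCLM y) →
                (ε * 2 ^ m - 1) / 2 ≤ ‖τ‖) := by
  obtain ⟨Y, E, S, hY, h⟩ := exists_isBlockSystem hdim hX
  suffices key : ∃ T : (ℕ → Bool) → (Y →L[𝕜] X),
        (∀ α : ℕ → Bool, IsCompactOperator (T α) ∧ ‖T α‖ ≤ 1) ∧
        ∀ ε : ℝ, 0 < ε → ε < 1 →
          ∃ A : (ℕ → Bool) → Emb 𝕜 Y X,
            (∀ α : ℕ → Bool, (A α).toCLM = Y.subtypeL + (ε : 𝕜) • T α) ∧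
            IsBorelReduction relE0 (Emb.position 𝕜 Y X) A ∧
            (∃ c : ℕ → ℕ, ∀ (m : ℕ) (α β : ℕ → Bool), AgreeFrom m α β →
              Emb.SamePositionWithin (c m : ℝ) (A α) (A β)) ∧
            (∀ (m n : ℕ) (α β : ℕ → Bool), m ≤ n → α n = false → β n = true →
              ∀ τ : X →L[𝕜] X, (∀ y : Y, τ ((A α).toCLM y) = (A β).toCLM y) →
                (ε * 2 ^ m - 1) / 2 ≤ ‖τ‖) by
    obtain ⟨T, hT, hA⟩ := key
    obtain ⟨A, -, hred, -⟩ := hA (1 / 2) (by norm_num) (by norm_num)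
    exact ⟨Y, hY, h.not_finiteDimensional, ⟨A, hred⟩,
      hred.not_isSmoothRel not_isSmoothRel_relE0, T, hT, hA⟩
  -- The zeros interleaved at odd places guarantee infinite codimension for every `α`, even an
  -- eventually constant one. They shift index `n` to `2 * n`, which only improves the lower bound.
  refine ⟨fun α => blockSum Y S (interleaveFalse α), fun α =>
    ⟨h.isCompactOperator_blockSum _, h.norm_blockSum_le _⟩, fun ε hε hε1 => ?_⟩
  let A : (ℕ → Bool) → Emb 𝕜 Y X := fun α =>
    { toCLM := Y.subtypeL + (ε : 𝕜) • blockSum Y S (interleaveFalse α)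
      bounded_below := ⟨1 - ε, by linarith, h.le_norm_perturbation hε _⟩
      infinite_codim := h.not_cofg_range_perturbation hY hε hε1 (exists_interleaveFalse_eq_false α) }
  have lower : ∀ (m n : ℕ) (α β : ℕ → Bool), m ≤ n → α n = false → β n = true →
      ∀ τ : X →L[𝕜] X, (∀ y : Y, τ ((A α).toCLM y) = (A β).toCLM y) →
        ε * 2 ^ m - 1 ≤ ‖τ‖ := by
    intro m n α β hmn hα hβ τ hτ
    have h1 := h.le_norm_of_perturbation hε (n := 2 * n)
      ((interleaveFalse_two_mul α n).trans hα) ((interleaveFalse_two_mul β n).trans hβ) τ hτ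
    have h2 : ε * (2 : ℝ) ^ m ≤ ε * 2 ^ (2 * n) :=
      mul_le_mul_of_nonneg_left (pow_le_pow_right₀ (by norm_num) (by omega)) hε.le
    linarith
  have upper : ∀ (m : ℕ) (α β : ℕ → Bool), AgreeFrom m α β → Emb.SamePositionWithin
      (⌈1 + ∑ n ∈ Finset.range (2 * m), ‖S n‖⌉₊ : ℝ) (A α) (A β) := by
    intro m α β hαβ
    obtain ⟨τ, hτ, hτn⟩ := h.exists_automorphism hε hε1 hαβ.interleaveFalse
    exact ⟨τ, hτ, hτn.trans (Nat.le_ceil _)⟩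
  refine ⟨A, fun α => rfl, ⟨?_, fun α β => ⟨?_, ?_⟩⟩, ⟨_, upper⟩, fun m n α β hmn hα hβ τ hτ => ?_⟩
  · exact Emb.measurable_of_continuous (continuous_const.add
      ((h.continuous_blockSum.comp continuous_interleaveFalse).const_smul (ε : 𝕜)))
  · rintro ⟨m, hm⟩
    obtain ⟨τ, hτ, -⟩ := upper m β α fun n hn => (hm n hn).symm
    exact ⟨τ, fun y => (hτ y).symm⟩
  · rintro ⟨τ, hτ⟩
    by_contra hne
    have hne' : ∀ m, ∃ n, m ≤ n ∧ α n ≠ β n := by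
      intro m
      by_contra! hm
      exact hne ⟨m, hm⟩
    -- Beyond this `m` a single disagreement forces a norm larger than both `‖τ‖` and `‖τ⁻¹‖`; its
    -- direction decides which of the two is contradicted.
    obtain ⟨m, hm⟩ := pow_unbounded_of_one_lt
      ((max ‖(τ : X →L[𝕜] X)‖ ‖(τ.symm : X →L[𝕜] X)‖ + 1) / ε) (one_lt_two : (1 : ℝ) < 2)
    rw [div_lt_iff₀ hε, mul_comm] at hm
    obtain ⟨n, hmn, hn⟩ := hne' m
    have h1 := le_max_left ‖(τ : X →L[𝕜] X)‖ ‖(τ.symm : X →L[𝕜] X)‖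
    have h2 := le_max_right ‖(τ : X →L[𝕜] X)‖ ‖(τ.symm : X →L[𝕜] X)‖
    cases hα : α n <;> cases hβ : β n
    · exact hn (hα.trans hβ.symm)
    · have := lower m n α β hmn hα hβ τ.symm fun y => by
        rw [hτ y]
        exact τ.symm_apply_apply _
      linarith
    · have := lower m n β α hmn hβ hα τ fun y => (hτ y).symm
      linarith
    · exact hn (hα.trans hβ.symm)
  · have h1 := lower m n α β hmn hα hβ τ hτ
    have h2 := norm_nonneg τ
    linarith
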